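/- Let $N\ge 1$ be an integer and let $\Gamma_1,\dots,\Gamma_N$ be positive rational numbers. For pairwise distinct $z_1,\dots,z_N\in\mathbb R^2$ write $\mathbf z=(z_1,\dots,z_N)$, $z_i=(x_i,y_i)$, and $$H(\mathbf z)=-\frac1{4\pi}\sum_{1\le i<j\le N}\Gamma_i\Gamma_j\log|z_i-z_j|^2 .$$ Consider the planar $N$-vortex problem $\Gamma_i\dot z_i(t)=\mathbb J\,\nabla_{z_i}H(\mathbf z(t))$, $1\le i\le N$, where $\mathbb J=\begin{pmatrix}0&1\\-1&0\end{pmatrix}$. A relative equilibrium is a periodic (collision-free) solution of the form $z_i(t)=e^{\mathbb J\omega t}(z_i(0)-c)+c$ for some $\omega\in\mathbb R$, where $c=\sum_i\Gamma_iz_i(0)/\sum_i\Gamma_i$ is the vorticity centre. It is normalised if $\sum_i\Gamma_ix_i(t)=\sum_i\Gamma_iy_i(t)=0$ and $\sum_i\Gamma_i|z_i(t)|^2=1$ for all $t$. Let $$\mathcal H_1=\{\,h\in\mathbb R : h=H(\mathbf z)\text{ for some normalised relative equilibrium }\mathbf z\,\}$$ (this is well defined, since $H$ is constant along solutions). Then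 $\mathcal H_1$ is a finite set. -/

import Mathlib

namespace NVortex

/-- The Euclidean plane `ℝ²`, in which a single vortex moves. -/
abbrev Plane : Type := EuclideanSpace ℝ (Fin 2)

/-- Configurations `z = (z₁, …, z_N)` of `N` points of the plane. -/
abbrev Config (N : ℕ) : Type := Fin N → Plane

/-- The matrix `𝕁 = [[0, 1], [-1, 0]]`. -/
def J : Matrix (Fin 2) (Fin 2) ℝ := !![0, 1; -1, 0]

/-- A `2 × 2` matrix acting on a point of the plane. -/
def act (A : Matrix (Fin 2) (Fin 2) ℝ) (v : Plane) : Plane :=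
  WithLp.toLp 2 (A.mulVec v.ofLp)

variable {N : ℕ}

/-- The Hamiltonian `H(z) = -(1/4π) ∑_{i < j} Γᵢ Γⱼ log |zᵢ - zⱼ|²`
(meaningful at configurations without collision). -/
noncomputable def H (Γ : Fin N → ℝ) (z : Config N) : ℝ :=
  -(1 / (4 * Real.pi)) * ∑ i, ∑ j ∈ Finset.Ioi i, Γ i * Γ j * Real.log (‖z i - z j‖ ^ 2)

/-- `z` has no collision: its points are pairwise distinct. -/
def CollisionFree (z : Config N) : Prop := ∀ i j, i ≠ j → z i ≠ z j

/-- `P(z) = ∑ Γᵢ xᵢ`. -/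
def P (Γ : Fin N → ℝ) (z : Config N) : ℝ := ∑ i, Γ i * z i 0

/-- `Q(z) = ∑ Γᵢ yᵢ`. -/
def Q (Γ : Fin N → ℝ) (z : Config N) : ℝ := ∑ i, Γ i * z i 1

/-- `I(z) = ∑ Γᵢ |zᵢ|²`. -/
noncomputable def I (Γ : Fin N → ℝ) (z : Config N) : ℝ := ∑ i, Γ i * ‖z i‖ ^ 2

/-- The `i`-th block `∇_{zᵢ} H(z)` of the gradient of `H`: the gradient with respect to the position
of the `i`-th vortex. -/
noncomputable def gradH (Γ : Fin N → ℝ) (z : Config N) (i : Fin N) : Plane :=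
  gradient (fun w : Plane => H Γ (Function.update z i w)) (z i)

/-- `z : ℝ → ℝ^{2N}` is a (collision-free, global) solution of the `N`-vortex problem
`Γᵢ żᵢ(t) = 𝕁 ∇_{zᵢ} H(z(t))`, `1 ≤ i ≤ N`. -/
structure IsOrbit (Γ : Fin N → ℝ) (z : ℝ → Config N) : Prop where
  collisionFree : ∀ t, CollisionFree (z t)
  differentiable : ∀ i, Differentiable ℝ (fun t => z t i)
  eqn : ∀ t i, Γ i • deriv (fun s => z s i) t = act J (gradH Γ (z t) i)

/-- Centred curves: `P(z(t)) = Q(z(t)) = 0`. -/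
def IsCentred (Γ : Fin N → ℝ) (z : ℝ → Config N) : Prop :=
  ∀ t, P Γ (z t) = 0 ∧ Q Γ (z t) = 0

/-- Normalised curves: centred, with `I(z(t)) = 1`. -/
def IsNormalised (Γ : Fin N → ℝ) (z : ℝ → Config N) : Prop :=
  IsCentred Γ z ∧ ∀ t, I Γ (z t) = 1

/-- The vorticity centre `(∑ Γᵢ zᵢ) / (∑ Γᵢ)`. -/
noncomputable def vorticityCentre (Γ : Fin N → ℝ) (z : Config N) : Plane :=
  (∑ i, Γ i)⁻¹ • ∑ i, Γ i • z i

/-- Relative equilibria: periodic solutions (with non-zero total vorticity) of the form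
`zᵢ(t) = e^{𝕁 ω t} (zᵢ(0) - c) + c`, where `c` is the vorticity centre. -/
structure IsRelativeEquilibrium (Γ : Fin N → ℝ) (z : ℝ → Config N) : Prop where
  isOrbit : IsOrbit Γ z
  total_ne_zero : ∑ i, Γ i ≠ 0
  periodic : ∃ T : ℝ, 0 < T ∧ ∀ t, z t = z (t + T)
  rotating : ∃ ω : ℝ, ∀ t i, z t i =
    act (NormedSpace.exp ((ω * t) • J)) (z 0 i - vorticityCentre Γ (z 0)) + vorticityCentre Γ (z 0)

/-- The set `𝒵₁` of normalised relative equilibria. -/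
def Z₁ (Γ : Fin N → ℝ) : Set (ℝ → Config N) :=
  {z | IsRelativeEquilibrium Γ z ∧ IsNormalised Γ z}

/-- The set `ℋ₁` of energy levels of normalised relative equilibria
(the energy is constant along an orbit, so the choice of `t` does not matter). -/
def H₁ (Γ : Fin N → ℝ) : Set ℝ := {h | ∃ z ∈ Z₁ Γ, ∃ t : ℝ, h = H Γ (z t)}

end NVortex

/-!
The energy levels are values of a function at its critical points on an algebraic set, and an
algebraic form of Sard's theorem shows that there are finitely many of them.

At each time a normalised relative equilibrium satisfies `∇_{zᵢ} H = ω Γᵢ zᵢ`, that is, it is a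
critical point of `H` restricted to `I = 1`
(`NVortex.exists_gradH_eq_of_isRelativeEquilibrium`). As the `Γᵢ` are rational and positive, there
is an integer `m > 0` for which all `n_{ab} = m ΓₐΓ_b` are natural numbers, and `H` is a function of
the polynomial `F = ∏_{a < b} |zₐ - z_b|^{2 n_{ab}}` (`NVortex.H_eq_log_prod`). It remains to see
that `F` takes finitely many values on the set of critical points.

Let `A` be the algebra of functions on the critical set generated by the coordinates, the inverses
of the squared distances and the Lagrange multiplier. The equations of the critical points give
`dF = F · d log F = m ν F · dI = 0` in the module of Kähler differentials `Ω[A⁄ℝ]`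
(`Derivation.leibniz_prod_pow_of_mul_eq_one`, `Derivation.sum_vortex_eq_zero`). In a finitely
generated algebra over a field of characteristic zero, an element without differential is algebraic
(`Algebra.isAlgebraic_of_kaehlerDifferential_D_eq_zero`): otherwise it would remain transcendental
in the fraction field `K` of a quotient of `A` by a prime, and `K`, being formally smooth over the
polynomial ring in that element, would give it a nonzero differential. So all values of `F` are
roots of a single polynomial.
-/

/-! ### An algebraic form of Sard's theorem -/

section AlgebraicSard

open Polynomial TensorProduct

/-- In an essentially finitely generated field extension of characteristic zero, an element whose
differential vanishes is algebraic. If `f` were transcendental, `K` would be formally smooth over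
the polynomial ring `k[X]` acting through `X ↦ f`, and `dX` would survive in `Ω[K⁄k]`. -/
theorem Field.isAlgebraic_of_kaehlerDifferential_D_eq_zero {k K : Type*} [Field k] [CharZero k]
    [Field K] [Algebra k K] [Algebra.EssFiniteType k K] {f : K}
    (hf : KaehlerDifferential.D k K f = 0) : IsAlgebraic k f := by
  by_contra htr
  let : Algebra k[X] K := (aeval f).toAlgebra
  have hmap (p : k[X]) : algebraMap k[X] K p = aeval f p := rfl
  have : IsScalarTower k k[X] K := .of_algebraMap_eq fun r => by simp [hmap]
  have : FaithfulSMul k[X] K := (faithfulSMul_iff_algebraMap_injective k[X] K).mpr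
    (transcendental_iff_injective.mp htr)
  let : Algebra (FractionRing k[X]) K := FractionRing.liftAlgebra k[X] K
  have : Algebra.EssFiniteType k[X] K := .of_comp k k[X] K
  have : Algebra.EssFiniteType (FractionRing k[X]) K := .of_comp k[X] _ K
  have : CharZero (FractionRing k[X]) :=
    charZero_of_injective_algebraMap (IsFractionRing.injective k[X] _)
  have : Algebra.FormallyEtale k[X] (FractionRing k[X]) :=
    .of_isLocalization (nonZeroDivisors k[X])
  have : Algebra.FormallySmooth k[X] K := .comp _ (FractionRing k[X]) _
  have : Subsingleton (Algebra.H1Cotangent k[X] K) :=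
    Algebra.FormallySmooth.subsingleton_h1Cotangent
  have hdX : (1 : K) ⊗ₜ[k[X]] KaehlerDifferential.D k k[X] X = 0 := by
    obtain ⟨y, hy⟩ := (Algebra.H1Cotangent.exact_δ_mapBaseChange k k[X] K _).mp
      (show KaehlerDifferential.mapBaseChange k k[X] K
        ((1 : K) ⊗ₜ[k[X]] KaehlerDifferential.D k k[X] X) = 0 by simp [hmap, hf])
    rw [← hy, Subsingleton.elim y 0, map_zero]
  have h := congrArg (fun t => TensorProduct.rid k[X] K
    ((KaehlerDifferential.polynomialEquiv k).toLinearMap.lTensor K t)) hdX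
  simp at h

/-- In a finitely generated algebra over a field of characteristic zero, an element whose
differential vanishes is algebraic. This is an algebraic form of Sard's theorem: a function without
differential takes finitely many values. -/
theorem Algebra.isAlgebraic_of_kaehlerDifferential_D_eq_zero {k A : Type*} [Field k] [CharZero k]
    [CommRing A] [Algebra k A] [Algebra.FiniteType k A] {f : A}
    (hf : KaehlerDifferential.D k A f = 0) : IsAlgebraic k f := by
  by_contra htr
  have hinj : Function.Injective (aeval (R := k) f) := transcendental_iff_injective.mp htr
  -- A prime avoiding all nonzero polynomials in `f`, so that `f` stays transcendental modulo it.
  obtain ⟨p, hp, -, hdisj⟩ := Ideal.exists_le_prime_disjoint (⊥ : Ideal A)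
    ((nonZeroDivisors k[X]).map (aeval (R := k) f)) (by
      rw [Set.disjoint_left]
      rintro _ h0 ⟨q, hq, rfl⟩
      exact nonZeroDivisors.ne_zero hq (hinj (by simpa using h0)))
  let K := FractionRing (A ⧸ p)
  have : Algebra.EssFiniteType (A ⧸ p) K := .of_isLocalization _ (nonZeroDivisors (A ⧸ p))
  have : Algebra.EssFiniteType k K := .comp k (A ⧸ p) K
  have : IsScalarTower k A K := .to₁₂₄ k A (A ⧸ p) K
  have hD : KaehlerDifferential.D k K (algebraMap A K f) = 0 := by
    rw [← KaehlerDifferential.map_D k k A K, hf, map_zero]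
  obtain ⟨q, hq0, hq⟩ := Field.isAlgebraic_of_kaehlerDifferential_D_eq_zero hD
  have hqp : aeval f q ∈ p := by
    rw [aeval_algebraMap_apply, IsScalarTower.algebraMap_apply A (A ⧸ p) K] at hq
    exact Ideal.Quotient.eq_zero_iff_mem.mp
      ((IsFractionRing.injective (A ⧸ p) K) (by simpa using hq))
  exact Set.disjoint_left.mp hdisj hqp ⟨q, mem_nonZeroDivisors_of_ne_zero hq0, rfl⟩

/-- A member of a finitely generated algebra of functions `V → k` whose differential vanishes takes
only finitely many values. -/
theorem Subalgebra.finite_range_of_kaehlerDifferential_D_eq_zero {k V : Type*} [Field k] [CharZero k]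
    (A : Subalgebra k (V → k)) (hA : A.FG) (f : A) (hf : KaehlerDifferential.D k A f = 0) :
    (Set.range (f : V → k)).Finite := by
  have : Algebra.FiniteType k A := A.fg_iff_finiteType.mp hA
  obtain ⟨q, hq0, hq⟩ := Algebra.isAlgebraic_of_kaehlerDifferential_D_eq_zero hf
  refine (q.rootSet_finite k).subset ?_
  rintro _ ⟨v, rfl⟩
  rw [mem_rootSet]
  refine ⟨hq0, ?_⟩
  have := congrArg ((Pi.evalAlgHom k (fun _ : V => k) v).comp A.val) hq
  rwa [← aeval_algHom_apply, map_zero] at this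

end AlgebraicSard

/-! ### The differential of the product of distances -/

section LogarithmicDerivative

/-- The logarithmic derivative of a product of powers of units. -/
theorem Derivation.leibniz_prod_pow_of_mul_eq_one {R A M ι : Type*} [CommRing R] [CommRing A]
    [Algebra R A] [AddCommGroup M] [Module A M] [Module R M] (D : Derivation R A M)
    (s : Finset ι) (d u : ι → A) (hdu : ∀ i ∈ s, d i * u i = 1) (n : ι → ℕ) :
    D (∏ i ∈ s, d i ^ n i) = (∏ i ∈ s, d i ^ n i) • ∑ i ∈ s, ((n i : A) * u i) • D (d i) := by
  classical
  induction s using Finset.induction_on with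
  | empty => simp
  | insert a s ha ih =>
    rw [Finset.prod_insert ha, Finset.sum_insert ha, D.leibniz,
      ih fun i hi => hdu i (Finset.mem_insert_of_mem hi), D.leibniz_pow]
    have h1 := hdu a (Finset.mem_insert_self a s)
    have h2 : (n a : A) * d a ^ (n a - 1) = d a ^ n a * ((n a : A) * u a) := by
      rcases h : n a with _ | m
      · simp
      · rw [Nat.add_sub_cancel, pow_succ]
        linear_combination (-(((m + 1 : ℕ) : A)) * d a ^ m) * h1
    rw [← Nat.cast_smul_eq_nsmul A, smul_smul (n a : A), h2, smul_add, smul_smul, smul_smul,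
      smul_smul, add_comm]
    congr 2
    ring

/-- If `n` is proportional to the products of vorticities and the equilibrium equations hold in `A`,
then `∑_{a < b} n_{ab} d log |z_a - z_b|²` vanishes. -/
theorem Derivation.sum_vortex_eq_zero {A M : Type*} [CommRing A]
    [Algebra ℝ A] [AddCommGroup M] [Module A M] [Module ℝ M] [IsScalarTower ℝ A M]
    (D : Derivation ℝ A M) {N : ℕ}
    (Γ : Fin N → ℝ) (x : Fin N → Fin 2 → A) (u : Fin N → Fin N → A) (ν : A) (m : ℕ)
    (n : Fin N → Fin N → ℕ) (hn : ∀ a b, (n a b : ℝ) = m * (Γ a * Γ b))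
    (heq : ∀ i c, ∑ a, ∑ b ∈ Finset.Ioi a, algebraMap ℝ A (Γ a * Γ b) * u a b *
      (((if a = i then 1 else 0) - if b = i then 1 else 0) * (x a c - x b c)) = ν * (algebraMap ℝ A (Γ i) * x i c))
    (hI : ∑ i, algebraMap ℝ A (Γ i) * ∑ c, x i c ^ 2 = 1) :
    ∑ a, ∑ b ∈ Finset.Ioi a, ((n a b : A) * u a b) • D (∑ c, (x a c - x b c) ^ 2) = 0 := by
  have hD (a b : Fin N) (c : Fin 2) :
      ∑ i, ((if a = i then 1 else 0) - (if b = i then 1 else 0) : A) • D (x i c) = D (x a c - x b c) := by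
    simp [sub_smul, Finset.sum_sub_distrib, ite_smul]
  have hn' (a b) : (n a b : A) = m * algebraMap ℝ A (Γ a * Γ b) := by
    rw [← _root_.map_natCast (algebraMap ℝ A), hn, _root_.map_mul, _root_.map_natCast]
  have hDI : ∑ i, ∑ c, (2 * (algebraMap ℝ A (Γ i) * x i c)) • D (x i c) = 0 := by
    have := congrArg D hI
    rw [D.map_one_eq_zero, map_sum] at this
    rw [← this]
    refine Finset.sum_congr rfl fun i _ => ?_
    rw [D.leibniz, D.map_algebraMap, smul_zero, add_zero, map_sum, Finset.smul_sum]
    refine Finset.sum_congr rfl fun c _ => ?_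
    rw [D.leibniz_pow, ← Nat.cast_smul_eq_nsmul A, smul_smul, smul_smul]
    congr 1
    push_cast
    ring
  have key : ∑ a, ∑ b ∈ Finset.Ioi a, ((n a b : A) * u a b) • D (∑ c, (x a c - x b c) ^ 2)
      = ((m : A) * ν) • ∑ i, ∑ c, (2 * (algebraMap ℝ A (Γ i) * x i c)) • D (x i c) := by
    calc _ = ∑ a, ∑ b ∈ Finset.Ioi a, ∑ i, ∑ c, (2 * m * (algebraMap ℝ A (Γ a * Γ b) * u a b *
      (((if a = i then 1 else 0) - if b = i then 1 else 0) * (x a c - x b c)))) • D (x i c) := by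
          refine Finset.sum_congr rfl fun a _ => Finset.sum_congr rfl fun b _ => ?_
          rw [map_sum, Finset.smul_sum, Finset.sum_comm]
          refine Finset.sum_congr rfl fun c _ => ?_
          rw [D.leibniz_pow, ← hD, hn', ← Nat.cast_smul_eq_nsmul A, smul_smul, smul_smul,
            Finset.smul_sum]
          refine Finset.sum_congr rfl fun i _ => ?_
          rw [smul_smul]
          congr 1
          push_cast
          ring
      _ = ∑ i, ∑ c, (2 * m * (ν * (algebraMap ℝ A (Γ i) * x i c))) • D (x i c) := by
          simp_rw [← heq, Finset.mul_sum, Finset.sum_smul]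
          simp_rw [Finset.sum_comm (s := Finset.Ioi _) (t := (Finset.univ : Finset (Fin N)))]
          rw [Finset.sum_comm]
          refine Finset.sum_congr rfl fun i _ => ?_
          simp_rw [Finset.sum_comm (s := Finset.Ioi _) (t := (Finset.univ : Finset (Fin 2)))]
          rw [Finset.sum_comm]
      _ = _ := by
          simp_rw [Finset.smul_sum, smul_smul]
          refine Finset.sum_congr rfl fun i _ => Finset.sum_congr rfl fun c _ => ?_
          congr 1
          ring
  rw [key, hDI, smul_zero]

end LogarithmicDerivative

/-! ### Relative equilibria as critical points -/

namespace NVortex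

section Equations

variable {N : ℕ}

theorem hasFDerivAt_update_apply {ι E : Type*} [DecidableEq ι] [NormedAddCommGroup E]
    [NormedSpace ℝ E] (z : ι → E) (i a : ι) :
    HasFDerivAt (fun w : E => Function.update z i w a)
      ((if a = i then 1 else 0 : ℝ) • ContinuousLinearMap.id ℝ E) (z i) := by
  by_cases h : a = i
  · subst h
    simp only [Function.update_self, if_true, one_smul]
    exact hasFDerivAt_id (z a)
  · simpa [h] using hasFDerivAt_const (z a) (z i)

/-- The gradient of `H` in `zᵢ`, as a sum over pairs `a < b`; the factor `δ_{ai} - δ_{bi}` is the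
derivative of `zₐ - z_b` in `zᵢ`. -/
theorem gradH_eq (Γ : Fin N → ℝ) {z : Config N} (hz : CollisionFree z) (i : Fin N) :
    gradH Γ z i = -(1 / (2 * Real.pi)) • ∑ a, ∑ b ∈ Finset.Ioi a,
      (Γ a * Γ b * (‖z a - z b‖ ^ 2)⁻¹ *
        ((if a = i then 1 else 0) - if b = i then 1 else 0)) • (z a - z b) := by
  refine HasGradientAt.gradient (hasGradientAt_iff_hasFDerivAt.mpr ?_)
  have hpair (a : Fin N) (b) (hb : b ∈ Finset.Ioi a) :
      HasFDerivAt (fun w : Plane => Γ a * Γ b *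
          Real.log (‖Function.update z i w a - Function.update z i w b‖ ^ 2))
        ((Γ a * Γ b) • (‖z a - z b‖ ^ 2)⁻¹ • (2 • (innerSL ℝ (z a - z b)) ∘SL
          ((if a = i then 1 else 0 : ℝ) • ContinuousLinearMap.id ℝ Plane -
            (if b = i then 1 else 0 : ℝ) • ContinuousLinearMap.id ℝ Plane))) (z i) := by
    have h := ((hasFDerivAt_update_apply z i a).fun_sub (hasFDerivAt_update_apply z i b)).norm_sq
    have hne : ‖z a - z b‖ ^ 2 ≠ 0 := by
      have := hz a b (Finset.mem_Ioi.mp hb).ne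
      simpa [sub_eq_zero] using this
    have h2 := (h.log (by simpa only [Function.update_eq_self] using hne)).const_mul (Γ a * Γ b)
    simpa only [Function.update_eq_self] using h2
  have hsum := (HasFDerivAt.fun_sum fun a (_ : a ∈ Finset.univ) =>
    HasFDerivAt.fun_sum fun b hb => hpair a b hb).const_mul (-(1 / (4 * Real.pi)))
  refine hsum.congr_fderiv ?_
  ext v
  simp only [smul_apply, sum_apply, InnerProductSpace.toDual_apply_apply, inner_smul_left,
    sum_inner, Finset.smul_sum, smul_eq_mul]
  refine Finset.sum_congr rfl fun a _ => Finset.sum_congr rfl fun b _ => ?_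
  simp [inner_sub_left]
  field_simp
  split_ifs <;> simp <;> ring

theorem act_mul (A B : Matrix (Fin 2) (Fin 2) ℝ) (v : Plane) : act (A * B) v = act A (act B v) := by
  simp only [act, Matrix.mulVec_mulVec]

theorem act_smul (A : Matrix (Fin 2) (Fin 2) ℝ) (r : ℝ) (v : Plane) :
    act A (r • v) = r • act A v := by
  simp only [act, WithLp.ofLp_smul, Matrix.mulVec_smul, WithLp.toLp_smul]

theorem act_J_injective : Function.Injective (act J) := by
  have h (v : Plane) : act (-J) (act J v) = v := by
    rw [← act_mul]
    have : -J * J = 1 := by ext i j; fin_cases i <;> fin_cases j <;> simp [J, Matrix.mul_apply]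
    simp [this, act]
  exact Function.LeftInverse.injective h

open scoped Matrix.Norms.Operator in
theorem hasDerivAt_act_exp (ω : ℝ) (v : Plane) (t : ℝ) :
    HasDerivAt (fun s : ℝ => act (NormedSpace.exp ((ω * s) • J)) v)
      (ω • act J (act (NormedSpace.exp ((ω * t) • J)) v)) t := by
  have h1 := (hasDerivAt_exp_smul_const' (𝕂 := ℝ) J (ω * t)).scomp t
    ((hasDerivAt_id t).const_mul ω)
  let e : Matrix (Fin 2) (Fin 2) ℝ →ₗ[ℝ] Plane :=
    { toFun := fun A => act A v
      map_add' := fun A B => by simp only [act, Matrix.add_mulVec, WithLp.toLp_add]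
      map_smul' := fun r A => by
        simp only [act, Matrix.smul_mulVec, WithLp.toLp_smul, RingHom.id_apply] }
  have h2 := (e.toContinuousLinearMap.hasFDerivAt).comp_hasDerivAt t h1
  -- The operator norm induces the product topology by definition, so `NormedSpace.exp` is the same.
  have h3 : e ((ω * 1) • (J * NormedSpace.exp ((ω * t) • J))) =
      ω • act J (act (NormedSpace.exp ((ω * t) • J)) v) := by
    rw [map_smul, mul_one, ← act_mul]
    rfl
  rw [← h3]
  exact h2

theorem vorticityCentre_eq_zero {Γ : Fin N → ℝ} {z : Config N} (hP : P Γ z = 0) (hQ : Q Γ z = 0) :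
    vorticityCentre Γ z = 0 := by
  have h : ∑ i, Γ i • z i = 0 := by
    ext c
    fin_cases c
    · simpa [P] using hP
    · simpa [Q] using hQ
  rw [vorticityCentre, h, smul_zero]

/-- At each time, a centred relative equilibrium is a critical point of `H` on a level set
of `I`, with a Lagrange multiplier proportional to its angular velocity. -/
theorem exists_gradH_eq_of_isRelativeEquilibrium {Γ : Fin N → ℝ}
    {z : ℝ → Config N} (hz : IsRelativeEquilibrium Γ z) (hc : IsCentred Γ z) :
    ∃ ω : ℝ, ∀ t i, gradH Γ (z t) i = (ω * Γ i) • z t i := by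
  obtain ⟨ω, hω⟩ := hz.rotating
  rw [vorticityCentre_eq_zero (hc 0).1 (hc 0).2] at hω
  simp only [sub_zero, add_zero] at hω
  refine ⟨ω, fun t i => act_J_injective ?_⟩
  have hd : deriv (fun s => z s i) t = ω • act J (z t i) := by
    rw [funext fun s => hω s i, (hasDerivAt_act_exp ω (z 0 i) t).deriv, hω t i]
  rw [← hz.isOrbit.eqn t i, hd, act_smul, smul_smul, mul_comm]

end Equations

end NVortex

/-! ### Finiteness of the critical values -/

namespace NVortex

section Finiteness

variable {N : ℕ}

/-- Pairs `(z, ν)` of a collision-free configuration `z` with `I(z) = 1` and a multiplier `ν` for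
which `∑_{a < b} ΓₐΓ_b |zₐ - z_b|⁻² ∂ᵢ|zₐ - z_b|² / 2 = ν Γᵢ zᵢ` for every `i`; the factor
`δ_{ai} - δ_{bi}` records the dependence of `zₐ - z_b` on `zᵢ`. Up to the normalisation of `ν`
this is the equation for critical points of `H` on `I = 1`. -/
def criticalPairs (Γ : Fin N → ℝ) : Set (Config N × ℝ) :=
  {p | CollisionFree p.1 ∧ I Γ p.1 = 1 ∧ ∀ i, ∑ a, ∑ b ∈ Finset.Ioi a,
    (Γ a * Γ b * (‖p.1 a - p.1 b‖ ^ 2)⁻¹ *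
      ((if a = i then 1 else 0) - if b = i then 1 else 0)) • (p.1 a - p.1 b) =
        (p.2 * Γ i) • p.1 i}

theorem exists_mem_criticalPairs {Γ : Fin N → ℝ} {z : ℝ → Config N} (hz : z ∈ Z₁ Γ) (t : ℝ) :
    ∃ ν, (z t, ν) ∈ criticalPairs Γ := by
  obtain ⟨hz, hc, hI⟩ := hz
  obtain ⟨ω, hω⟩ := exists_gradH_eq_of_isRelativeEquilibrium hz hc
  refine ⟨-(2 * Real.pi) * ω, hz.isOrbit.collisionFree t, hI t, fun i => ?_⟩
  have h := hω t i
  rw [gradH_eq Γ (hz.isOrbit.collisionFree t)] at h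
  have h2 := congrArg (fun w => (-(2 * Real.pi)) • w) h
  simp only [smul_smul] at h2
  rw [show -(2 * Real.pi) * -(1 / (2 * Real.pi)) = 1 by field_simp, one_smul] at h2
  rw [h2, mul_assoc]

/-- The products `ΓₐΓ_b` of rational vorticities have a common denominator. -/
theorem exists_nat_eq_mul_of_rat {Γ : Fin N → ℝ} (hΓ : ∀ i, ∃ q : ℚ, 0 < q ∧ Γ i = (q : ℝ)) :
    ∃ (m : ℕ) (n : Fin N → Fin N → ℕ), m ≠ 0 ∧ ∀ a b, (n a b : ℝ) = m * (Γ a * Γ b) := by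
  choose q hq hΓq using hΓ
  obtain ⟨e, he⟩ : ∃ e : Fin N → ℕ, ∀ i, (e i : ℚ) = (∏ j, (q j).den : ℕ) * q i := by
    have h (i : Fin N) : ∃ e : ℕ, (e : ℚ) = (∏ j, (q j).den : ℕ) * q i := by
      obtain ⟨c, hc⟩ := Finset.dvd_prod_of_mem (fun j => (q j).den) (Finset.mem_univ i)
      refine ⟨c * (q i).num.toNat, ?_⟩
      have hnum : (((q i).num.toNat : ℤ) : ℚ) = (q i).num := by
        rw [Int.toNat_of_nonneg (Rat.num_nonneg.mpr (hq i).le)]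
      rw [hc]
      push_cast at hnum ⊢
      rw [hnum, ← Rat.den_mul_eq_num]
      ring
    choose e he using h
    exact ⟨e, he⟩
  refine ⟨(∏ j, (q j).den) ^ 2, fun a b => e a * e b,
    pow_ne_zero _ (Finset.prod_ne_zero_iff.mpr fun j _ => (q j).den_nz), fun a b => ?_⟩
  have : ((e a * e b : ℕ) : ℚ) = ((∏ j, (q j).den) ^ 2 : ℕ) * (q a * q b) := by
    rw [Nat.cast_mul, he, he, Nat.cast_pow]
    ring
  rw [hΓq, hΓq]
  exact_mod_cast this

/-- The product `∏_{a < b} |zₐ - z_b|^{2 n_{ab}}`, where `n_{ab}` is proportional to `ΓₐΓ_b`, takes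
finitely many values at critical points. -/
theorem finite_range_prod_dist (Γ : Fin N → ℝ) (m : ℕ) (n : Fin N → Fin N → ℕ)
    (hn : ∀ a b, (n a b : ℝ) = m * (Γ a * Γ b)) :
    (Set.range fun p : criticalPairs Γ =>
      ∏ s ∈ Finset.univ.sigma fun a : Fin N => Finset.Ioi a,
        (‖p.1.1 s.1 - p.1.1 s.2‖ ^ 2) ^ n s.1 s.2).Finite := by
  -- The algebra of functions on the critical set generated by coordinates, inverse squared
  -- distances and the multiplier.
  let gen : (Fin N × Fin 2) ⊕ (Fin N × Fin N) ⊕ Unit → criticalPairs Γ → ℝ :=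
    Sum.elim (fun s p => p.1.1 s.1 s.2)
      (Sum.elim (fun s p => (‖p.1.1 s.1 - p.1.1 s.2‖ ^ 2)⁻¹) (fun _ p => p.1.2))
  let A : Subalgebra ℝ (criticalPairs Γ → ℝ) := Algebra.adjoin ℝ (Set.range gen)
  have hA : A.FG := Subalgebra.fg_def.mpr ⟨_, Set.finite_range gen, rfl⟩
  let g (s) : A := ⟨gen s, Algebra.subset_adjoin ⟨s, rfl⟩⟩
  let ev (p : criticalPairs Γ) : A →ₐ[ℝ] ℝ := (Pi.evalAlgHom ℝ (fun _ => ℝ) p).comp A.val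
  have ext_ev {f f' : A} (h : ∀ p, ev p f = ev p f') : f = f' := Subtype.ext (funext h)
  let x (i : Fin N) (c : Fin 2) : A := g (.inl (i, c))
  let u (a b : Fin N) : A := g (.inr (.inl (a, b)))
  let ν : A := g (.inr (.inr ()))
  have ev_x (p i c) : ev p (x i c) = p.1.1 i c := rfl
  have ev_u (p a b) : ev p (u a b) = (‖p.1.1 a - p.1.1 b‖ ^ 2)⁻¹ := rfl
  have ev_ν (p) : ev p ν = p.1.2 := rfl
  let d (a b : Fin N) : A := ∑ c, (x a c - x b c) ^ 2
  have ev_d (p a b) : ev p (d a b) = ‖p.1.1 a - p.1.1 b‖ ^ 2 := by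
    simp only [d, map_sum, map_pow, map_sub, ev_x, EuclideanSpace.real_norm_sq_eq, PiLp.sub_apply]
  have hdu (a b : Fin N) (hab : a ≠ b) : d a b * u a b = 1 := ext_ev fun p => by
    rw [map_mul, ev_d, ev_u, map_one]
    have := p.2.1 a b hab
    exact mul_inv_cancel₀ (by simpa [sub_eq_zero] using this)
  have hI : ∑ i, algebraMap ℝ A (Γ i) * ∑ c, x i c ^ 2 = 1 := ext_ev fun p => by
    have := p.2.2.1
    simp only [I, EuclideanSpace.real_norm_sq_eq] at this
    simpa only [map_sum, map_mul, map_pow, ev_x, map_one, AlgHom.commutes,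
      Algebra.algebraMap_self_apply] using this
  have heq (i : Fin N) (c : Fin 2) : ∑ a, ∑ b ∈ Finset.Ioi a, algebraMap ℝ A (Γ a * Γ b) * u a b *
      (((if a = i then 1 else 0) - if b = i then 1 else 0) * (x a c - x b c)) =
        ν * (algebraMap ℝ A (Γ i) * x i c) := ext_ev fun p => by
    have h := congrArg (fun w : Plane => w c) (p.2.2.2 i)
    simp only [PiLp.smul_apply, smul_eq_mul, WithLp.ofLp_sum, Finset.sum_apply, PiLp.sub_apply] at h
    simp only [map_sum, map_mul, map_sub, ev_x, ev_u, ev_ν, AlgHom.commutes,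
      Algebra.algebraMap_self_apply, apply_ite (ev p), map_one, map_zero]
    rw [← mul_assoc, ← h]
    refine Finset.sum_congr rfl fun a _ => Finset.sum_congr rfl fun b _ => ?_
    ring
  let F : A := ∏ s ∈ Finset.univ.sigma fun a : Fin N => Finset.Ioi a, d s.1 s.2 ^ n s.1 s.2
  have hF : KaehlerDifferential.D ℝ A F = 0 := by
    rw [Derivation.leibniz_prod_pow_of_mul_eq_one (KaehlerDifferential.D ℝ A) _
      (fun s : (_ : Fin N) × Fin N => d s.1 s.2) (fun s => u s.1 s.2)
      (fun s hs => hdu _ _ (Finset.mem_Ioi.mp (Finset.mem_sigma.mp hs).2).ne), Finset.sum_sigma,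
      Derivation.sum_vortex_eq_zero _ Γ x u ν m n hn heq hI, smul_zero]
  convert A.finite_range_of_kaehlerDifferential_D_eq_zero hA F hF using 2
  funext p
  change _ = ev p F
  simp only [F, map_prod, map_pow, ev_d]

theorem H_eq_log_prod (Γ : Fin N → ℝ) {m : ℕ} (hm : m ≠ 0) (n : Fin N → Fin N → ℕ)
    (hn : ∀ a b, (n a b : ℝ) = m * (Γ a * Γ b)) {z : Config N} (hz : CollisionFree z) :
    H Γ z = -(1 / (4 * Real.pi * m)) * Real.log
      (∏ s ∈ Finset.univ.sigma fun a : Fin N => Finset.Ioi a, (‖z s.1 - z s.2‖ ^ 2) ^ n s.1 s.2) := by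
  have hm' : (m : ℝ) ≠ 0 := Nat.cast_ne_zero.mpr hm
  rw [Real.log_prod, Finset.sum_sigma, H]
  · have h (a b : Fin N) : Real.log ((‖z a - z b‖ ^ 2) ^ n a b) =
        m * (Γ a * Γ b * Real.log (‖z a - z b‖ ^ 2)) := by
      rw [Real.log_pow, hn, mul_assoc]
    simp only [h, ← Finset.mul_sum]
    field_simp
  · intro s hs
    have := hz _ _ (Finset.mem_Ioi.mp (Finset.mem_sigma.mp hs).2).ne
    exact pow_ne_zero _ (by simpa [sub_eq_zero] using this)

end Finiteness

end NVortex

theorem theorem3 (N : ℕ) (Γ : Fin N → ℝ) (hΓ : ∀ i, ∃ q : ℚ, 0 < q ∧ Γ i = (q : ℝ)) :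
    (NVortex.H₁ Γ).Finite := by
  obtain ⟨m, n, hm, hn⟩ := NVortex.exists_nat_eq_mul_of_rat hΓ
  refine ((NVortex.finite_range_prod_dist Γ m n hn).image
    fun y => -(1 / (4 * Real.pi * m)) * Real.log y).subset ?_
  rintro _ ⟨z, hz, t, rfl⟩
  obtain ⟨ν, hν⟩ := NVortex.exists_mem_criticalPairs hz t
  exact ⟨_, ⟨⟨(z t, ν), hν⟩, rfl⟩, (NVortex.H_eq_log_prod Γ hm n hn hν.1).symm⟩
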